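/- Let $w_1,\dots,w_n\in\mathbb{C}$ be distinct, let $\mu_1,\dots,\mu_n\ge 1$ be integers, and put $N=\mu_1+\dots+\mu_n$, $$p(z)=\prod_{j=1}^n (z-w_j)^{\mu_j},\qquad Z(z)=\begin{pmatrix}1&z&\cdots&z^{N-1}\end{pmatrix}.$$ Let $\Omega\subset\mathbb{C}$ be an open (possibly disconnected) set containing $w_1,\dots,w_n$, and let $\Omega_0$ be an open neighborhood of the origin such that $p^{-1}(\Omega_0)\subset\Omega$ and such that every connected component of $\Omega$ meets $p^{-1}(\Omega_0)$. Let $K$ be a complex-valued positive definite kernel on $\Omega$ and let $L$ be a $\mathbb{C}^{N\times N}$-valued positive definite kernel on $\Omega_0$, both analytic in the first variable and in the complex conjugate of the second variable (that is, $(z,u)\mapsto K(z,\overline u)$ and the entries of $(z,u)\mapsto L(z,\overline u)$ are analytic functions of two complex variables), and suppose that $$K(z,w)=Z(z)\,L(p(z),p(w))\,Z(w)^*,\qquad z,w\in p^{-1}(\Omega_0).$$ Let $\mathcal{H}(K)$ (complex-valued functions on $\Omega$) and $\mathcal{H}(L)$ ($\mathbb{C}^N$-valued functions on $\Omega_0$)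 be the reproducing kernel Hilbert spaces with reproducing kernels $K$ and $L$. Then for every $F\in\mathcal{H}(L)$ the function $z\mapsto Z(z)F(p(z))$, defined on $p^{-1}(\Omega_0)$, extends to an analytic function on $\Omega$, and this extension is an element of $\mathcal{H}(K)$. Moreover, there is exactly one map $S:\mathcal{H}(L)\to\mathcal{H}(K)$ such that $$(SF)(z)=Z(z)F(p(z)),\qquad F\in\mathcal{H}(L),\ z\in p^{-1}(\Omega_0),$$ and $S$ is a unitary operator from $\mathcal{H}(L)$ onto $\mathcal{H}(K)$. -/

import Mathlib

open scoped ComplexConjugate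

noncomputable section

namespace CompMult

/-- The polynomial function `p(z) = ∏ j, (z - w j) ^ μ j`. -/
def nodePoly {n : ℕ} (w : Fin n → ℂ) (μ : Fin n → ℕ) (z : ℂ) : ℂ :=
  ∏ j, (z - w j) ^ μ j

/-- The row vector `Z(z) = (1, z, …, z ^ (N - 1))`. -/
def rowZ (N : ℕ) (z : ℂ) : Fin N → ℂ := fun k => z ^ (k : ℕ)

/-- The complex-valued function `k(z, w)` is analytic in `z` and in `conj w`, for `z` and `w`
in `s`: the function `(z, u) ↦ k(z, conj u)` of two complex variables is analytic at every point
`(z, u)` such that `z` and `conj u` lie in `s`. -/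
def AnalyticKernelOn (s : Set ℂ) (k : ℂ → ℂ → ℂ) : Prop :=
  AnalyticOnNhd ℂ (fun q : ℂ × ℂ => k q.1 (conj q.2)) {q | q.1 ∈ s ∧ conj q.2 ∈ s}

open scoped ComplexOrder in
/-- The complex-valued kernel `K` is positive definite on `s`: it is Hermitian, and
`∑ conj (c z) * K(z, w) * c w ≥ 0` for every finitely supported family `c` of complex
numbers. -/
def PosKernelOn (s : Set ℂ) (K : ℂ → ℂ → ℂ) : Prop :=
  (Matrix.of fun z w : s => K z w).PosSemidef

open scoped ComplexOrder in
/-- The `N × N` matrix-valued kernel `L` is positive definite on `s`: it is Hermitian, and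
`∑ (c z)^* L(z, w) (c w) ≥ 0` for every finitely supported family `c` of vectors of `ℂ^N`. -/
def PosMatrixKernelOn {N : ℕ} (s : Set ℂ) (L : ℂ → ℂ → Matrix (Fin N) (Fin N) ℂ) : Prop :=
  (Matrix.of fun a b : s × Fin N => L a.1 b.1 a.2 b.2).PosSemidef

/-- `H` is the reproducing kernel Hilbert space `ℋ(K)`: a Hilbert space of complex-valued
functions on `s` whose reproducing kernel is `K`. -/
def IsRKHSOf {s : Set ℂ} (H : Type*) [NormedAddCommGroup H] [InnerProductSpace ℂ H]
    [CompleteSpace H] [RKHS ℂ H s ℂ] (K : ℂ → ℂ → ℂ) : Prop :=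
  ∀ (z w : s) (c : ℂ), RKHS.kernel H z w c = K z w * c

/-- `H` is the reproducing kernel Hilbert space `ℋ(L)`: a Hilbert space of `ℂ^N`-valued
functions on `s` whose reproducing kernel is `L`. -/
def IsMatrixRKHSOf {s : Set ℂ} {N : ℕ} (H : Type*) [NormedAddCommGroup H]
    [InnerProductSpace ℂ H] [CompleteSpace H] [RKHS ℂ H s (EuclideanSpace ℂ (Fin N))]
    (L : ℂ → ℂ → Matrix (Fin N) (Fin N) ℂ) : Prop :=
  ∀ z w : s, RKHS.kernel H z w = Matrix.toEuclideanCLM (𝕜 := ℂ) (L z w)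

end CompMult

end

namespace CompMult

open Filter Topology Polynomial

/-! For `z` in `p⁻¹(Ω₀)`, the kernel identity says that the vectors `a z = L(·, p z) Z(z)^*` of
`ℋ(L)` and `b z = K(·, z)` of `ℋ(K)` have equal Gram matrices. If both families have dense span, `a
z ↦ b z` extends to a unitary, and pairing `S F` with `b z = S (a z)` gives the required formula.

The `b z` span densely by the identity theorem: elements of `ℋ(K)` are holomorphic, and `p⁻¹(Ω₀)` is
open and meets every component of `Ω`. For the `a z`, suppose `Z(z) F(p z) = 0` throughout
`p⁻¹(Ω₀)`. Off the critical values of `p`, a value `t` has `N` distinct preimages, so an invertible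
Vandermonde matrix kills `F t`. Critical values are finite in number and `F` is continuous, so `F =
0`. -/

theorem denseRange_linearCombination_of_orthogonal_eq_bot {ι E : Type*}
    [NormedAddCommGroup E] [InnerProductSpace ℂ E] [CompleteSpace E] {a : ι → E}
    (ha : (Submodule.span ℂ (Set.range a))ᗮ = ⊥) :
    DenseRange (Finsupp.linearCombination ℂ a) := by
  rw [← Submodule.topologicalClosure_eq_top_iff,
    ← Submodule.dense_iff_topologicalClosure_eq_top, ← Finsupp.range_linearCombination,
    LinearMap.coe_range] at ha
  exact ha

/-- Two families with dense spans and equal Gram matrices are unitarily equivalent. -/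
theorem exists_linearIsometryEquiv_of_inner_eq {ι E F : Type*}
    [NormedAddCommGroup E] [InnerProductSpace ℂ E] [CompleteSpace E]
    [NormedAddCommGroup F] [InnerProductSpace ℂ F] [CompleteSpace F]
    (a : ι → E) (b : ι → F) (ha : (Submodule.span ℂ (Set.range a))ᗮ = ⊥)
    (hb : (Submodule.span ℂ (Set.range b))ᗮ = ⊥)
    (hab : ∀ i j, inner ℂ (a i) (a j) = inner ℂ (b i) (b j)) :
    ∃ U : E ≃ₗᵢ[ℂ] F, ∀ i, U (a i) = b i := by
  have hda := denseRange_linearCombination_of_orthogonal_eq_bot ha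
  have hdb := denseRange_linearCombination_of_orthogonal_eq_bot hb
  have hnorm (x : ι →₀ ℂ) :
      ‖Finsupp.linearCombination ℂ b x‖ = ‖Finsupp.linearCombination ℂ a x‖ := by
    rw [← sq_eq_sq₀ (norm_nonneg _) (norm_nonneg _), ← inner_self_eq_norm_sq (𝕜 := ℂ),
      ← inner_self_eq_norm_sq (𝕜 := ℂ)]
    simp only [Finsupp.linearCombination_apply, Finsupp.sum_inner, Finsupp.inner_sum,
      inner_smul_left, inner_smul_right, hab]
  refine ⟨(LinearEquiv.refl ℂ (ι →₀ ℂ)).extendOfIsometry _ _ hda hdb hnorm,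
    fun i ↦ ?_⟩
  have := (LinearEquiv.refl ℂ (ι →₀ ℂ)).extendOfIsometry_eq _ _ hda hdb hnorm
    (Finsupp.single i 1)
  simpa using this

/-- If a polynomial of degree `N > 0` does not take the value `t` at a critical point, it takes
this value at `N` distinct points. -/
theorem exists_injective_eval_eq {P : ℂ[X]} {N : ℕ} (hP : P.natDegree = N) (hN : 0 < N) {t : ℂ}
    (ht : ∀ z, P.derivative.eval z = 0 → P.eval z ≠ t) :
    ∃ f : Fin N → ℂ, Function.Injective f ∧ ∀ i, P.eval (f i) = t := by
  classical
  have hdeg : (P - C t).natDegree = N := by rw [natDegree_sub_C, hP]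
  have hne : P - C t ≠ 0 := by
    rintro h
    rw [h, natDegree_zero] at hdeg
    omega
  -- A multiple root of `P - t` would be a critical point with value `t`.
  have hnodup : (P - C t).roots.Nodup := by
    rw [Multiset.nodup_iff_count_le_one]
    intro z
    rw [count_roots]
    by_contra! h
    rw [one_lt_rootMultiplicity_iff_isRoot hne] at h
    refine ht z ?_ ?_
    · simpa using h.2
    · simpa [sub_eq_zero] using h.1
  have hcard : (P - C t).roots.toFinset.card = N := by
    rw [Multiset.toFinset_card_of_nodup hnodup,
      ← (IsAlgClosed.splits (P - C t)).natDegree_eq_card_roots, hdeg]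
  refine ⟨fun i ↦ ((P - C t).roots.toFinset.equivFinOfCardEq hcard).symm i,
    Subtype.val_injective.comp (Equiv.injective _), fun i ↦ ?_⟩
  have h := (((P - C t).roots.toFinset.equivFinOfCardEq hcard).symm i).2
  rw [Multiset.mem_toFinset, mem_roots hne] at h
  simpa [sub_eq_zero] using h

theorem finite_setOf_criticalValue {P : ℂ[X]} (hP : 0 < P.natDegree) :
    {t : ℂ | ∃ z, P.derivative.eval z = 0 ∧ P.eval z = t}.Finite := by
  have hne : P.derivative ≠ 0 := fun h ↦ hP.ne' (derivative_eq_zero.1 h)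
  refine ((P.derivative.finite_setOfPred_isRoot hne).image P.eval).subset ?_
  rintro _ ⟨z, hz, rfl⟩
  exact ⟨z, hz, rfl⟩

/-- The node polynomial as a formal polynomial. -/
noncomputable def nodePolynomial {n : ℕ} (w : Fin n → ℂ) (μ : Fin n → ℕ) : ℂ[X] :=
  ∏ j, (X - C (w j)) ^ μ j

theorem eval_nodePolynomial {n : ℕ} (w : Fin n → ℂ) (μ : Fin n → ℕ) (z : ℂ) :
    (nodePolynomial w μ).eval z = nodePoly w μ z := by
  simp [nodePolynomial, nodePoly, eval_prod]

theorem natDegree_nodePolynomial {n : ℕ} (w : Fin n → ℂ) (μ : Fin n → ℕ) :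
    (nodePolynomial w μ).natDegree = ∑ j, μ j := by
  rw [nodePolynomial, natDegree_prod_of_monic _ _ fun j _ ↦ (monic_X_sub_C _).pow _]
  simp

theorem continuous_nodePoly {n : ℕ} (w : Fin n → ℂ) (μ : Fin n → ℕ) :
    Continuous (nodePoly w μ) := by
  unfold nodePoly
  fun_prop

/-- A continuous vector function `F` with `Z(z) F(p(z)) = 0` vanishes. -/
theorem eqOn_zero_of_rowZ_dotProduct_eq_zero {n N : ℕ} {w : Fin n → ℂ} {μ : Fin n → ℕ}
    (hN : ∑ j, μ j = N) {s : Set ℂ} (hs : IsOpen s) {F : ℂ → EuclideanSpace ℂ (Fin N)}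
    (hF : ContinuousOn F s)
    (h : ∀ z, nodePoly w μ z ∈ s → rowZ N z ⬝ᵥ (F (nodePoly w μ z)).ofLp = 0) :
    ∀ t ∈ s, F t = 0 := by
  rcases N.eq_zero_or_pos with rfl | hpos
  -- For `N = 0` the polynomial is constant and every point is critical, but `ℂ^0` is trivial.
  · exact fun t _ ↦ Subsingleton.elim _ _
  have hdeg := (natDegree_nodePolynomial w μ).trans hN
  have hfin := finite_setOf_criticalValue (hdeg.symm ▸ hpos)
  set A := {t : ℂ | ∃ z, (nodePolynomial w μ).derivative.eval z = 0 ∧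
    (nodePolynomial w μ).eval z = t}
  have hzero : ∀ t ∈ s, t ∉ A → F t = 0 := by
    intro t hts htA
    obtain ⟨f, hf, hft⟩ := exists_injective_eval_eq hdeg hpos
      fun z hz hzt ↦ htA ⟨z, hz, hzt⟩
    have hv : (F t).ofLp = 0 := by
      -- Vandermonde: the rows `Z(f j)` at `N` distinct points are linearly independent.
      refine Matrix.eq_zero_of_forall_index_sum_pow_mul_eq_zero hf fun j ↦ ?_
      have hj := hft j
      rw [eval_nodePolynomial] at hj
      have := h (f j) (hj ▸ hts)
      rw [hj] at this
      simpa [dotProduct, rowZ] using this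
    ext i
    simp [hv]
  intro t hts
  -- Even if `t` is critical, the finitely many other critical values stay away from it.
  have hev : ∀ᶠ z in 𝓝[≠] t, F z = 0 := by
    have hA : ∀ᶠ z in 𝓝[≠] t, z ∉ A := by
      have := (hfin.subset (Set.sdiff_subset (s := A) (t := {t}))).isClosed.isOpen_compl.mem_nhds
        (x := t) (by simp)
      filter_upwards [nhdsWithin_le_nhds this, self_mem_nhdsWithin] with z hz hzt hzA
      exact hz ⟨hzA, hzt⟩
    filter_upwards [nhdsWithin_le_nhds (hs.mem_nhds hts), hA] with z hzs hzA
    exact hzero z hzs hzA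
  refine tendsto_nhds_unique (l := 𝓝[≠] t)
    ((hF.continuousAt (hs.mem_nhds hts)).tendsto.mono_left nhdsWithin_le_nhds) ?_
  exact tendsto_const_nhds.congr' (hev.mono fun z hz ↦ hz.symm)

/-! ### Holomorphy in reproducing kernel spaces -/

section RKHS

variable {s : Set ℂ} {V H : Type*} [NormedAddCommGroup V] [InnerProductSpace ℂ V]
  [NormedAddCommGroup H] [InnerProductSpace ℂ H] [RKHS ℂ H s V]

open scoped Classical in
/-- An element of a reproducing kernel Hilbert space of functions on `s ⊆ ℂ`, extended by zero. -/
noncomputable def zeroExtend (f : H) (z : ℂ) : V := if h : z ∈ s then f ⟨z, h⟩ else 0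

theorem zeroExtend_of_mem (f : H) {z : ℂ} (hz : z ∈ s) : zeroExtend f z = f ⟨z, hz⟩ :=
  dif_pos hz

theorem zeroExtend_coe (f : H) (z : s) : zeroExtend f (z : ℂ) = f z :=
  zeroExtend_of_mem f z.2

variable [CompleteSpace H] [CompleteSpace V]

/-- Norm convergence implies locally uniform convergence if the kernel is continuous on the
diagonal. -/
theorem tendstoLocallyUniformlyOn_zeroExtend (hk : Continuous fun x : s ↦ RKHS.kernel H x x)
    {ι : Type*} {l : Filter ι} {u : ι → H} {f : H} (hu : Tendsto u l (𝓝 f)) :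
    TendstoLocallyUniformlyOn (fun i ↦ zeroExtend (u i)) (zeroExtend f) l s := by
  rw [tendstoLocallyUniformlyOn_iff_tendstoLocallyUniformly_comp_coe]
  have hcoe (g : H) : zeroExtend g ∘ ((↑) : s → ℂ) = g := funext (zeroExtend_coe g)
  simp only [hcoe, zeroExtend_coe]
  intro W hW x
  refine ⟨{y | ‖RKHS.kernel H y y‖ < ‖RKHS.kernel H x x‖ + 1},
    (isOpen_lt hk.norm continuous_const).mem_nhds (by simp), ?_⟩
  refine RKHS.tendstoUniformlyOn_of_norm_kerFun_le (C := √(‖RKHS.kernel H x x‖ + 1))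
    (fun y hy ↦ ?_) hu W hW
  rw [RKHS.norm_kerFun_eq_sqrt_norm_kernel]
  exact Real.sqrt_le_sqrt (Set.mem_ofPred_eq ▸ hy).le

/-- If the kernel is continuous on the diagonal and the kernel functions are holomorphic, then all
elements of the space are holomorphic. -/
theorem differentiableOn_zeroExtend (hs : IsOpen s)
    (hk : Continuous fun x : s ↦ RKHS.kernel H x x)
    (hd : ∀ (u : s) (v : V), DifferentiableOn ℂ (zeroExtend (RKHS.kerFun H u v)) s) (f : H) :
    DifferentiableOn ℂ (zeroExtend f) s := by
  -- The subspace of holomorphic elements contains the kernel functions, whose span is dense;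
  -- locally uniform limits remain holomorphic.
  let D : Submodule ℂ H :=
    { carrier := {f | DifferentiableOn ℂ (zeroExtend f) s}
      zero_mem' := by
        refine (differentiableOn_const (0 : V)).congr fun z hz ↦ ?_
        simp [zeroExtend_of_mem _ hz]
      add_mem' := fun {f g} hf hg ↦ by
        refine (DifferentiableOn.add hf hg).congr fun z hz ↦ ?_
        simp [zeroExtend_of_mem _ hz]
      smul_mem' := fun c f hf ↦ by
        refine (DifferentiableOn.const_smul hf c).congr fun z hz ↦ ?_
        simp [zeroExtend_of_mem _ hz] }
  have hspan : Submodule.span ℂ {RKHS.kerFun H x v | (x) (v)} ≤ D := by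
    rw [Submodule.span_le]
    rintro _ ⟨x, v, rfl⟩
    exact hd x v
  have hf : f ∈ (Submodule.span ℂ {RKHS.kerFun H x v | (x) (v)}).topologicalClosure := by
    rw [RKHS.kerFun_dense]
    trivial
  rw [← SetLike.mem_coe, Submodule.topologicalClosure_coe, mem_closure_iff_seq_limit] at hf
  obtain ⟨u, hu, hlim⟩ := hf
  exact (tendstoLocallyUniformlyOn_zeroExtend hk hlim).differentiableOn
    (Eventually.of_forall fun i ↦ hspan (hu i)) hs

end RKHS

/-! ### Scalar kernels and the identity theorem -/

section Scalar

variable {s : Set ℂ} {k : ℂ → ℂ → ℂ}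

theorem AnalyticKernelOn.differentiableOn (h : AnalyticKernelOn s k) {u : ℂ} (hu : u ∈ s) :
    DifferentiableOn ℂ (fun z ↦ k z u) s := by
  intro z hz
  have h1 := (h (z, conj u) ⟨hz, by simpa using hu⟩).differentiableAt
  have h2 : DifferentiableAt ℂ (fun z : ℂ ↦ (z, conj u)) z := by fun_prop
  simpa [Function.comp_def] using (h1.comp z h2).differentiableWithinAt

theorem AnalyticKernelOn.continuous_diagonal (h : AnalyticKernelOn s k) :
    Continuous fun z : s ↦ k z z := by
  have h2 : Continuous fun z : s ↦ ((z : ℂ), conj (z : ℂ)) := by fun_prop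
  have := h.continuousOn.comp_continuous h2 fun z ↦ by simp
  simpa [Function.comp_def] using this

variable {H : Type*} [NormedAddCommGroup H] [InnerProductSpace ℂ H] [CompleteSpace H]
  [RKHS ℂ H s ℂ]

theorem IsRKHSOf.differentiableOn (hH : IsRKHSOf H k) (hs : IsOpen s)
    (hk : AnalyticKernelOn s k) (f : H) : DifferentiableOn ℂ (zeroExtend f) s := by
  refine differentiableOn_zeroExtend hs ?_ (fun u v ↦ ?_) f
  · have : (fun x : s ↦ RKHS.kernel H x x) = fun x : s ↦ k x x • ContinuousLinearMap.id ℂ ℂ := by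
      funext x
      ext
      simp [hH x x]
    rw [this]
    exact hk.continuous_diagonal.smul continuous_const
  · refine ((hk.differentiableOn u.2).mul_const v).congr fun z hz ↦ ?_
    rw [zeroExtend_of_mem _ hz, RKHS.kerFun_apply, hH]

/-- A function in `ℋ(k)` vanishing on an open set that meets all components is zero. -/
theorem IsRKHSOf.eq_zero (hH : IsRKHSOf H k) (hs : IsOpen s) (hk : AnalyticKernelOn s k)
    {t : Set ℂ} (ht : IsOpen t) (hst : ∀ z ∈ s, (connectedComponentIn s z ∩ t).Nonempty) {f : H}
    (hf : ∀ z (hz : z ∈ s), z ∈ t → f ⟨z, hz⟩ = 0) : f = 0 := by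
  have hfa := (hH.differentiableOn hs hk f).analyticOnNhd hs
  ext z
  obtain ⟨a, haz, hat⟩ := hst z z.2
  have has := connectedComponentIn_subset _ _ haz
  have hev : zeroExtend f =ᶠ[𝓝 a] 0 := by
    filter_upwards [hs.mem_nhds has, ht.mem_nhds hat] with b hbs hbt
    simp [zeroExtend_of_mem f hbs, hf b hbs hbt]
  have := (hfa.mono (connectedComponentIn_subset s z)).eqOn_zero_of_preconnected_of_eventuallyEq_zero
    isPreconnected_connectedComponentIn haz hev (mem_connectedComponentIn z.2)
  simpa [zeroExtend_coe] using this

end Scalar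

/-! ### Matrix-valued kernels -/

section Matrix

variable {s : Set ℂ} {N : ℕ} {L : ℂ → ℂ → Matrix (Fin N) (Fin N) ℂ}
  {H : Type*} [NormedAddCommGroup H] [InnerProductSpace ℂ H] [CompleteSpace H]
  [RKHS ℂ H s (EuclideanSpace ℂ (Fin N))]

theorem IsMatrixRKHSOf.differentiableOn (hH : IsMatrixRKHSOf H L) (hs : IsOpen s)
    (hL : ∀ i j, AnalyticKernelOn s fun z u ↦ L z u i j) (f : H) :
    DifferentiableOn ℂ (zeroExtend f) s := by
  refine differentiableOn_zeroExtend hs ?_ (fun u v ↦ ?_) f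
  · have hc : Continuous fun x : s ↦ L x x :=
      continuous_pi fun i ↦ continuous_pi fun j ↦ (hL i j).continuous_diagonal
    have he : Continuous (Matrix.toEuclideanCLM (𝕜 := ℂ) (n := Fin N)) :=
      (Matrix.toEuclideanCLM (𝕜 := ℂ) (n := Fin N)).toAlgEquiv.toLinearMap.continuous_of_finiteDimensional
    exact (he.comp hc).congr fun x ↦ (hH x x).symm
  · rw [differentiableOn_euclidean]
    intro i
    have : DifferentiableOn ℂ (fun z ↦ ∑ j, L z u i j * v j) s :=
      DifferentiableOn.fun_sum fun j _ ↦ ((hL i j).differentiableOn u.2).mul_const _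
    refine this.congr fun z hz ↦ ?_
    rw [zeroExtend_of_mem _ hz, RKHS.kerFun_apply, hH]
    simp [Matrix.mulVec, dotProduct]

end Matrix

end CompMult


theorem proposition5p2 {n N : ℕ} (w : Fin n → ℂ) (μ : Fin n → ℕ)
    (hw : Function.Injective w) (hμ : ∀ j, 1 ≤ μ j) (hN : ∑ j, μ j = N)
    (Ω Ω₀ : Set ℂ) (hΩ : IsOpen Ω) (hwΩ : ∀ j, w j ∈ Ω)
    (hΩ₀ : IsOpen Ω₀) (h0 : (0 : ℂ) ∈ Ω₀) (hsub : CompMult.nodePoly w μ ⁻¹' Ω₀ ⊆ Ω)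
    (hcomp : ∀ z ∈ Ω, (connectedComponentIn Ω z ∩ CompMult.nodePoly w μ ⁻¹' Ω₀).Nonempty)
    (K : ℂ → ℂ → ℂ) (hKpos : CompMult.PosKernelOn Ω K)
    (hKan : CompMult.AnalyticKernelOn Ω K)
    (L : ℂ → ℂ → Matrix (Fin N) (Fin N) ℂ) (hLpos : CompMult.PosMatrixKernelOn Ω₀ L)
    (hLan : ∀ i j, CompMult.AnalyticKernelOn Ω₀ (fun z u => L z u i j))
    (hKL : ∀ z u : ℂ, CompMult.nodePoly w μ z ∈ Ω₀ → CompMult.nodePoly w μ u ∈ Ω₀ →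
      K z u = CompMult.rowZ N z ⬝ᵥ
        (L (CompMult.nodePoly w μ z) (CompMult.nodePoly w μ u)).mulVec
          (star (CompMult.rowZ N u)))
    (HK : Type*) [NormedAddCommGroup HK] [InnerProductSpace ℂ HK] [CompleteSpace HK]
    [RKHS ℂ HK Ω ℂ] (hHK : CompMult.IsRKHSOf HK K)
    (HL : Type*) [NormedAddCommGroup HL] [InnerProductSpace ℂ HL] [CompleteSpace HL]
    [RKHS ℂ HL Ω₀ (EuclideanSpace ℂ (Fin N))] (hHL : CompMult.IsMatrixRKHSOf HL L) :
    (∀ F : HL, ∃ g : ℂ → ℂ, AnalyticOnNhd ℂ g Ω ∧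
      (∀ (z : ℂ) (hz : CompMult.nodePoly w μ z ∈ Ω₀),
        g z = CompMult.rowZ N z ⬝ᵥ (F ⟨CompMult.nodePoly w μ z, hz⟩).ofLp) ∧
      ∃ f : HK, ∀ z : Ω, f z = g z) ∧
    ∃ S : HL ≃ₗᵢ[ℂ] HK,
      (∀ (F : HL) (z : ℂ) (hz : CompMult.nodePoly w μ z ∈ Ω₀),
        S F ⟨z, hsub hz⟩ =
          CompMult.rowZ N z ⬝ᵥ (F ⟨CompMult.nodePoly w μ z, hz⟩).ofLp) ∧
      ∀ T : HL → HK,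
        (∀ (F : HL) (z : ℂ) (hz : CompMult.nodePoly w μ z ∈ Ω₀),
          T F ⟨z, hsub hz⟩ =
            CompMult.rowZ N z ⬝ᵥ (F ⟨CompMult.nodePoly w μ z, hz⟩).ofLp) →
        ∀ F : HL, T F = S F := by
  let p := CompMult.nodePoly w μ
  have hpre : IsOpen (p ⁻¹' Ω₀) := hΩ₀.preimage (CompMult.continuous_nodePoly w μ)
  -- The `star` offsets the conjugate linearity of the inner product in its first slot, so `a z`
  -- represents `F ↦ Z(z) F(p z)`.
  let a : p ⁻¹' Ω₀ → HL := fun z ↦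
    RKHS.kerFun HL ⟨p z, z.2⟩ (WithLp.toLp 2 (star (CompMult.rowZ N z)))
  let b : p ⁻¹' Ω₀ → HK := fun z ↦ RKHS.kerFun HK ⟨z, hsub z.2⟩ 1
  have ha_inner (z : p ⁻¹' Ω₀) (F : HL) :
      inner ℂ (a z) F = CompMult.rowZ N z ⬝ᵥ (F ⟨p z, z.2⟩).ofLp := by
    simp only [a]
    rw [RKHS.kerFun_inner, EuclideanSpace.inner_eq_star_dotProduct]
    simp [dotProduct_comm]
  have hb_inner (z : p ⁻¹' Ω₀) (f : HK) : inner ℂ (b z) f = f ⟨z, hsub z.2⟩ := by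
    simp only [b]
    rw [RKHS.kerFun_inner]
    simp
  have hHK {f : HK} (hf : ∀ z (hz : p z ∈ Ω₀), f ⟨z, hsub hz⟩ = 0) : f = 0 :=
    hHK.eq_zero hΩ hKan hpre hcomp fun z _ hz ↦ hf z hz
  have ha : (Submodule.span ℂ (Set.range a))ᗮ = ⊥ := by
    rw [Submodule.eq_bot_iff]
    intro F hF
    have hF0 := CompMult.eqOn_zero_of_rowZ_dotProduct_eq_zero (w := w) hN hΩ₀
      (hHL.differentiableOn hΩ₀ hLan F).continuousOn fun z hz ↦ by
        rw [CompMult.zeroExtend_of_mem F hz, ← ha_inner ⟨z, hz⟩]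
        exact hF _ (Submodule.subset_span ⟨_, rfl⟩)
    ext1 t
    rw [← CompMult.zeroExtend_coe, hF0 t t.2]
    simp
  have hb : (Submodule.span ℂ (Set.range b))ᗮ = ⊥ := by
    rw [Submodule.eq_bot_iff]
    intro f hf
    refine hHK fun z hz ↦ ?_
    rw [← hb_inner ⟨z, hz⟩]
    exact hf _ (Submodule.subset_span ⟨_, rfl⟩)
  have hab (z u : p ⁻¹' Ω₀) : inner ℂ (a z) (a u) = inner ℂ (b z) (b u) := by
    rw [ha_inner, hb_inner]
    simp only [a, b]
    rw [RKHS.kerFun_apply, RKHS.kerFun_apply, hHL, ‹CompMult.IsRKHSOf HK K›, mul_one,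
      hKL z u z.2 u.2]
    simp [p]
  obtain ⟨S, hS⟩ := CompMult.exists_linearIsometryEquiv_of_inner_eq a b ha hb hab
  have hSF (F : HL) (z : ℂ) (hz : p z ∈ Ω₀) :
      S F ⟨z, hsub hz⟩ = CompMult.rowZ N z ⬝ᵥ (F ⟨p z, hz⟩).ofLp := by
    rw [← hb_inner ⟨z, hz⟩, ← ha_inner ⟨z, hz⟩, ← hS, S.inner_map_map]
  refine ⟨fun F ↦ ⟨CompMult.zeroExtend (S F), ?_, fun z hz ↦ ?_, S F, fun z ↦ ?_⟩,
    S, hSF, fun T hT F ↦ ?_⟩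
  · exact (‹CompMult.IsRKHSOf HK K›.differentiableOn hΩ hKan (S F)).analyticOnNhd hΩ
  · rw [CompMult.zeroExtend_of_mem _ (hsub hz), hSF F z hz]
  · rw [CompMult.zeroExtend_coe]
  -- `T F` and `S F` agree on `p⁻¹(Ω₀)`, which determines an element of `ℋ(K)`.
  · rw [← sub_eq_zero]
    refine hHK fun z hz ↦ ?_
    rw [RKHS.coe_sub, Pi.sub_apply, hT F z hz, hSF F z hz, sub_self]
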